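/- Let $q$ be a prime power and let $X$ be the Hermitian curve $y^q+y=x^{q+1}$ over $\mathbb{F}_{q^2}$ (its smooth projective model), with function field $\mathbb{F}_{q^2}(X)$. Let $P_\infty$ be its point at infinity and $P_0$ the origin. For a divisor $G$ on $X$ let $L(G)=\{0\}\cup\{f\in\mathbb{F}_{q^2}(X)\setminus\{0\} : (f)+G\ge 0\}$. Let $P_1,\dots,P_n$ be pairwise distinct rational points of $X$ and, for integers $a,b$ such that no $P_k$ lies in the support of $aP_\infty+bP_0$, let $$C(a,b)=\{(f(P_1),\dots,f(P_n)) : f\in L(aP_\infty+bP_0)\}\subseteq\mathbb{F}_{q^2}^n .$$ For integers $a,b$ let $M_{P_\infty}(a,b)$ be the set of pairs $(f,g)$ of rational functions such that (1) $fg\in L(aP_\infty+bP_0)\setminus L((a-1)P_\infty+bP_0)$, (2) $f\in L(aP_\infty+bP_0)$, (3) $g\in L((a+b)P_\infty)$, and let $$m_{P_\infty}(a,b)=\#\{-b\le i\le a+1 : \exists (f,g)\in M_{P_\infty}(a+1,b)\text{ with } \operatorname{ord}_{P_\infty}(f)=-i\}.$$ **Theorem 2.1 (shift bound at $P_\infty$).**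 Let $a,b$ be integers such that no $P_k$ lies in the support of $aP_\infty+bP_0$ or of $(a+1)P_\infty+bP_0$. Let $\mathbf{c}=(c_1,\dots,c_n)\in\mathbb{F}_{q^2}^n$ be orthogonal, with respect to the bilinear form $\sum_k c_kw_k$, to $C(a,b)$ but not orthogonal to $C(a+1,b)$. Then the Hamming weight of $\mathbf{c}$ is at least $m_{P_\infty}(a,b)$. -/

import Mathlib

open Polynomial

noncomputable section

/-! ## Places, divisors, Riemann–Roch spaces and evaluation codes of a function field

The closed points of a smooth projective curve over `F` are the places of its function field `K`,
that is, the normalized discrete valuations of `K` that are trivial on `F`. -/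

namespace FunField

variable (F K : Type*) [Field F] [Field K] [Algebra F K]

/-- A place of `K / F`: a discrete valuation `ord : K → ℤ ∪ {∞}` which is normalized (onto `ℤ`) and
trivial on the constants. -/
structure Place where
  ord : AddValuation K (WithTop ℤ)
  ord_const : ∀ c : F, c ≠ 0 → ord (algebraMap F K c) = 0
  exists_uniformizer : ∃ t : K, ord t = 1

/-- Divisors: formal integral combinations of places. -/
abbrev Divisor := Place F K →₀ ℤ

variable {F K}

/-- A place is rational if its residue field is `F`. -/
def Place.IsRational (P : Place F K) : Prop :=
  ∀ f : K, 0 ≤ P.ord f → ∃ c : F, 0 < P.ord (f - algebraMap F K c)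

open Classical in
/-- The value `f(P) ∈ F` of a function at a place: the constant `c` such that `f - c` vanishes
at `P`. It exists and is unique if `P` is rational and `f` has no pole at `P`; the default `0` is
used when there is no such constant. -/
def Place.value (P : Place F K) (f : K) : F :=
  if h : ∃ c : F, 0 < P.ord (f - algebraMap F K c) then h.choose else 0

/-- `L(G)`: the functions `f` with `f = 0` or `(f) + G ≥ 0` (recall `ord 0 = ∞`). -/
def riemannRoch (G : Divisor F K) : Submodule F K where
  carrier := {f | ∀ P : Place F K, ((-(G P) : ℤ) : WithTop ℤ) ≤ P.ord f}
  zero_mem' := fun P => by rw [P.ord.map_zero]; exact le_top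
  add_mem' := fun {f g} hf hg P => P.ord.map_le_add (hf P) (hg P)
  smul_mem' := fun c f hf P => by
    by_cases hc : c = 0
    · rw [hc, zero_smul, P.ord.map_zero]; exact le_top
    · rw [Algebra.smul_def, P.ord.map_mul, P.ord_const c hc, zero_add]; exact hf P

/-- `C(D, G)`, for `D = P₁ + ⋯ + Pₙ`: the image of `L(G)` under `f ↦ (f(P₁), …, f(Pₙ))`. -/
def code {n : ℕ} (P : Fin n → Place F K) (G : Divisor F K) : Set (Fin n → F) :=
  (fun f k => (P k).value f) '' (riemannRoch G : Set K)

/-- The vector `c` is orthogonal to `C` for the standard bilinear form on `Fⁿ`. -/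
def IsOrthogonal {n : ℕ} (c : Fin n → F) (C : Set (Fin n → F)) : Prop :=
  ∀ w ∈ C, ∑ k, c k * w k = 0

end FunField

/-! ## The Hermitian curve `y ^ q + y = x ^ (q + 1)` over the field `F` with `q ^ 2` elements -/

namespace Hermitian

variable (F : Type*) [Field F] (q : ℕ)

/-- The equation of the curve, as a polynomial in `x` with coefficients in `F[y]`. -/
def equation : F[X][X] := X ^ (q + 1) - C (X ^ q + X)

/-- The affine coordinate ring `F[x, y] / (x ^ (q + 1) - (y ^ q + y))`. -/
abbrev CoordinateRing := AdjoinRoot (equation F q)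

/-- The function field of the Hermitian curve. -/
abbrev FunctionField := FractionRing (CoordinateRing F q)

lemma one_lt_of_card [Finite F] [h : Fact (Nat.card F = q ^ 2)] : 1 < q := by
  have h1 : 1 < Nat.card F := Finite.one_lt_card
  rw [h.out] at h1
  by_contra! hq
  interval_cases q <;> simp at h1

lemma equation_monic : (equation F q).Monic :=
  monic_X_pow_sub_C _ q.succ_ne_zero

lemma equation_irreducible (hq : 1 < q) : Irreducible (equation F q) := by
  have hdeg : (equation F q).natDegree = q + 1 := natDegree_X_pow_sub_C
  have hdeg' : (equation F q).degree = ((q + 1 : ℕ) : WithBot ℕ) :=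
    degree_X_pow_sub_C q.succ_pos _
  refine irreducible_of_eisenstein_criterion (P := Ideal.span {(X : F[X])})
    ((Ideal.span_singleton_prime X_ne_zero).2 prime_X) ?_ ?_ ?_ ?_ (equation_monic F q).isPrimitive
  · rw [(equation_monic F q).leadingCoeff, Ideal.mem_span_singleton, X_dvd_iff]
    simp
  · intro n hn
    rw [hdeg'] at hn
    have hn' : n < q + 1 := by exact_mod_cast hn
    rw [Ideal.mem_span_singleton, X_dvd_iff, equation, coeff_sub, coeff_X_pow, coeff_C,
      if_neg hn'.ne]
    split_ifs
    · simp [coeff_X_pow, show (0 : ℕ) ≠ q by omega]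
    · simp
  · rw [hdeg']; exact_mod_cast q.succ_pos
  · rw [Ideal.span_singleton_pow, Ideal.mem_span_singleton, equation, coeff_sub, coeff_X_pow,
      coeff_C_zero, if_neg (by omega), zero_sub, dvd_neg, X_pow_dvd_iff]
    intro h
    have := h 1 one_lt_two
    simp [coeff_X_pow, show (1 : ℕ) ≠ q by omega] at this

instance [Finite F] [Fact (Nat.card F = q ^ 2)] : IsDomain (CoordinateRing F q) :=
  AdjoinRoot.isDomain_of_prime (equation_irreducible F q (one_lt_of_card F q)).prime

/-- The coordinate function `x`. -/
def x : FunctionField F q := algebraMap (CoordinateRing F q) _ (AdjoinRoot.root _)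

/-- The coordinate function `y`. -/
def y : FunctionField F q := algebraMap (CoordinateRing F q) _ (AdjoinRoot.of _ X)

lemma curve_equation : y F q ^ q + y F q = x F q ^ (q + 1) := by
  have h := AdjoinRoot.eval₂_root (equation F q)
  have h' : AdjoinRoot.root (equation F q) ^ (q + 1) = AdjoinRoot.of (equation F q) (X ^ q + X) := by
    conv_lhs at h => arg 3; rw [equation]
    rwa [eval₂_sub, eval₂_pow, eval₂_X, eval₂_C, sub_eq_zero] at h
  rw [x, y, ← map_pow (algebraMap (CoordinateRing F q) (FunctionField F q)) (AdjoinRoot.root _), h',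
    map_add, map_add, map_pow, map_pow]

lemma algebraMap_eq_single (c : F) :
    algebraMap F (LaurentSeries F) c = HahnSeries.single 0 c := by
  rw [HahnSeries.algebraMap_apply', PowerSeries.algebraMap_apply, Algebra.algebraMap_self_apply,
    HahnSeries.ofPowerSeries_C, HahnSeries.C_apply]

/-- The variable of the field of Laurent series. -/
def t : LaurentSeries F := HahnSeries.single 1 1

lemma addVal_t : HahnSeries.addVal ℤ F (t F) = 1 := by
  rw [HahnSeries.addVal_apply, t, HahnSeries.orderTop_single one_ne_zero]; rfl

lemma addVal_const (c : F) (hc : c ≠ 0) :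
    HahnSeries.addVal ℤ F (HahnSeries.single 0 c) = 0 := by
  rw [HahnSeries.addVal_apply, HahnSeries.orderTop_single hc]; rfl

lemma addVal_powerSeries_nonneg (w : PowerSeries F) :
    0 ≤ HahnSeries.addVal ℤ F (HahnSeries.ofPowerSeries ℤ F w) := by
  rw [HahnSeries.addVal_apply, HahnSeries.le_orderTop_iff_forall]
  intro j hj
  have hj' : j < 0 := by exact_mod_cast hj
  rw [PowerSeries.coeff_coe, if_pos hj']

section Places

variable [Finite F] [Fact (Nat.card F = q ^ 2)]

variable {F q} in
/-- A parametrization of the curve by Laurent series `(ξ, η)`, with `η` transcendental over `F`,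
gives a homomorphism from the function field to the field of Laurent series. -/
def param (ξ η : LaurentSeries F) (h : η ^ q + η = ξ ^ (q + 1))
    (hη : Transcendental F η) : FunctionField F q →+* LaurentSeries F :=
  IsFractionRing.lift (A := CoordinateRing F q)
    (g := AdjoinRoot.lift (aeval η).toRingHom ξ (by
      rw [equation, eval₂_sub, eval₂_pow, eval₂_X, eval₂_C, sub_eq_zero]
      simp [h])) (by
    have := (equation_monic F q).finite_adjoinRoot
    refine (RingHom.injective_iff_ker_eq_bot _).2
      (Ideal.eq_bot_of_comap_eq_bot (R := F[X]) (eq_bot_iff.2 fun p hp => ?_))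
    rw [Ideal.mem_comap, RingHom.mem_ker, AdjoinRoot.algebraMap_eq, AdjoinRoot.lift_of] at hp
    exact (transcendental_iff_injective.1 hη) (hp.trans (map_zero (aeval η)).symm))

variable {F q} in
lemma param_x (ξ η : LaurentSeries F) (h : η ^ q + η = ξ ^ (q + 1)) (hη : Transcendental F η) :
    param ξ η h hη (x F q) = ξ := by
  rw [param, x, IsFractionRing.lift_algebraMap, AdjoinRoot.lift_root]

variable {F q} in
lemma param_y (ξ η : LaurentSeries F) (h : η ^ q + η = ξ ^ (q + 1)) (hη : Transcendental F η) :
    param ξ η h hη (y F q) = η := by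
  rw [param, y, IsFractionRing.lift_algebraMap, AdjoinRoot.lift_of]
  simp

variable {F q} in
lemma param_const (ξ η : LaurentSeries F) (h : η ^ q + η = ξ ^ (q + 1)) (hη : Transcendental F η)
    (c : F) : param ξ η h hη (algebraMap F _ c) = HahnSeries.single 0 c := by
  rw [IsScalarTower.algebraMap_apply F (CoordinateRing F q), param, IsFractionRing.lift_algebraMap,
    IsScalarTower.algebraMap_apply F F[X], AdjoinRoot.algebraMap_eq, AdjoinRoot.lift_of]
  simpa using algebraMap_eq_single F c

lemma exists_series : ∃ z : PowerSeries F,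
    z ^ q + z = PowerSeries.X ^ (q + 1) ∧ PowerSeries.constantCoeff z = 0 := by
  have hq := one_lt_of_card F q
  obtain ⟨z, hz, hz'⟩ := HenselianRing.is_henselian (I := Ideal.span {(PowerSeries.X : PowerSeries F)})
    (X ^ q + (X - C (PowerSeries.X ^ (q + 1))))
    (monic_X_pow_add (by rw [degree_X_sub_C]; exact_mod_cast hq)) 0
    (by
      simp [show q ≠ 0 by omega, Ideal.mem_span_singleton, pow_succ])
    (by
      rw [derivative_add, derivative_sub, derivative_X_pow, derivative_X, derivative_C]
      simp [show q - 1 ≠ 0 by omega])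
  refine ⟨z, ?_, ?_⟩
  · simp only [IsRoot, eval_add, eval_pow, eval_X, eval_sub, eval_C] at hz
    linear_combination hz
  · rwa [sub_zero, Ideal.mem_span_singleton, PowerSeries.X_dvd_iff] at hz'

/-- The Laurent series `z = t ^ (q + 1) - ⋯` with zero constant term and
`z ^ q + z = t ^ (q + 1)`. -/
def series : LaurentSeries F := HahnSeries.ofPowerSeries ℤ F (exists_series F q).choose

lemma series_equation : series F q ^ q + series F q = t F ^ (q + 1) := by
  rw [series, t, ← HahnSeries.ofPowerSeries_X, ← map_pow, ← map_pow, ← map_add,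
    (exists_series F q).choose_spec.1]

lemma addVal_series : HahnSeries.addVal ℤ F (series F q) = ((q + 1 : ℕ) : ℤ) := by
  have hq := one_lt_of_card F q
  obtain ⟨hz, hz0⟩ := (exists_series F q).choose_spec
  set z := (exists_series F q).choose with hzdef
  have hu : IsUnit (1 + z ^ (q - 1)) := by
    rw [PowerSeries.isUnit_iff_constantCoeff]
    simp [hz0, show q - 1 ≠ 0 by omega]
  obtain ⟨u, hu⟩ := hu
  have h1 : PowerSeries.X ^ (q + 1) = z * (u : PowerSeries F) := by
    rw [hu, ← hz, mul_add, mul_one, ← pow_succ', Nat.sub_add_cancel hq.le, add_comm]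
  have h2 : z = PowerSeries.X ^ (q + 1) * ((u⁻¹ : (PowerSeries F)ˣ) : PowerSeries F) := by
    rw [h1, mul_assoc, u.mul_inv, mul_one]
  have hX : HahnSeries.addVal ℤ F (HahnSeries.ofPowerSeries ℤ F PowerSeries.X ^ (q + 1)) =
      ((q + 1 : ℕ) : ℤ) := by
    rw [HahnSeries.ofPowerSeries_X, ← t, AddValuation.map_pow, addVal_t, nsmul_one]; rfl
  apply le_antisymm
  · rw [← hX, ← map_pow, h1, map_mul, AddValuation.map_mul]
    exact le_add_of_nonneg_right (addVal_powerSeries_nonneg F _)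
  · rw [series, ← hzdef, h2, map_mul, AddValuation.map_mul, map_pow, hX]
    exact le_add_of_nonneg_right (addVal_powerSeries_nonneg F _)

lemma series_ne_zero : series F q ≠ 0 := by
  intro h
  have := addVal_series F q
  rw [h, AddValuation.map_zero] at this
  exact WithTop.coe_ne_top this.symm

lemma series_transcendental : Transcendental F (series F q) := by
  rw [transcendental_iff]
  intro p hp
  by_contra hne
  obtain ⟨n, g, hg, rfl⟩ : ∃ (n : ℕ) (g : F[X]), g.coeff 0 ≠ 0 ∧ p = X ^ n * g := by
    obtain ⟨g, hg, hg'⟩ := exists_eq_pow_rootMultiplicity_mul_and_not_dvd p hne 0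
    rw [C_0, sub_zero] at hg hg'
    exact ⟨_, g, fun h => hg' (X_dvd_iff.2 h), hg⟩
  rw [map_mul, map_pow, aeval_X, mul_eq_zero,
    or_iff_right (pow_ne_zero _ (series_ne_zero F q))] at hp
  obtain ⟨hz, hz0⟩ := (exists_series F q).choose_spec
  have h : aeval (exists_series F q).choose g = 0 := by
    apply HahnSeries.ofPowerSeries_injective (Γ := ℤ) (R := F)
    rw [map_zero, ← hp, series, aeval_def, aeval_def, hom_eval₂]
    congr 1
  apply hg
  have h' := congrArg PowerSeries.constantCoeff h
  rw [aeval_def, hom_eval₂, hz0, map_zero, eval₂_at_zero] at h'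
  simpa using h'

/-- The place obtained from a parametrization by Laurent series: the order of a function is the
order in `t` of its Laurent expansion. -/
def placeOfParam (ξ η : LaurentSeries F) (h : η ^ q + η = ξ ^ (q + 1)) (hη : Transcendental F η)
    (hu : ∃ f, HahnSeries.addVal ℤ F (param ξ η h hη f) = 1) :
    FunField.Place F (FunctionField F q) where
  ord := (HahnSeries.addVal ℤ F).comap (param ξ η h hη)
  ord_const := fun c hc => by
    change HahnSeries.addVal ℤ F (param ξ η h hη _) = 0
    rw [param_const, addVal_const F c hc]
  exists_uniformizer := hu

/-- The origin `P₀`, with Laurent expansions `x = t`, `y = z`. It is the common zero of `x`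
and `y`. -/
def P₀ : FunField.Place F (FunctionField F q) :=
  placeOfParam F q (t F) (series F q) (series_equation F q) (series_transcendental F q)
    ⟨x F q, by rw [param_x, addVal_t]⟩

lemma series_equation_inf :
    (series F q)⁻¹ ^ q + (series F q)⁻¹ = (t F / series F q) ^ (q + 1) := by
  have h0 := series_ne_zero F q
  have hq : series F q ^ q * (series F q)⁻¹ ^ q = 1 := by
    rw [← mul_pow, mul_inv_cancel₀ h0, one_pow]
  rw [div_eq_mul_inv, mul_pow, ← series_equation, pow_succ (series F q)⁻¹]
  linear_combination (-(series F q)⁻¹) * hq - (series F q)⁻¹ ^ q * mul_inv_cancel₀ h0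

lemma series_inv_transcendental : Transcendental F (series F q)⁻¹ := fun h =>
  series_transcendental F q (IsAlgebraic.inv_iff.1 h)

/-- The point at infinity `P_∞`, with Laurent expansions `x = t / z`, `y = 1 / z`. It is the common
pole of `x` and `y`. -/
def Pinf : FunField.Place F (FunctionField F q) :=
  placeOfParam F q (t F / series F q) (series F q)⁻¹ (series_equation_inf F q)
    (series_inv_transcendental F q)
    ⟨x F q / y F q, by
      rw [map_div₀, param_x, param_y, div_inv_eq_mul, div_mul_cancel₀ _ (series_ne_zero F q),
        addVal_t]⟩

/-! The orders of the coordinate functions identify the two points. -/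

lemma ord_P₀_x : (P₀ F q).ord (x F q) = 1 := by
  change HahnSeries.addVal ℤ F (param _ _ _ _ _) = _
  rw [param_x, addVal_t]

lemma ord_P₀_y : (P₀ F q).ord (y F q) = ((q + 1 : ℕ) : ℤ) := by
  change HahnSeries.addVal ℤ F (param _ _ _ _ _) = _
  rw [param_y, addVal_series]

lemma ord_Pinf_y : (Pinf F q).ord (y F q) = (-(q + 1) : ℤ) := by
  change HahnSeries.addVal ℤ F (param _ _ _ _ _) = _
  rw [param_y, AddValuation.map_inv, addVal_series]
  rfl

lemma ord_Pinf_x : (Pinf F q).ord (x F q) = (-q : ℤ) := by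
  change HahnSeries.addVal ℤ F (param _ _ _ _ _) = _
  rw [param_x, div_eq_mul_inv, AddValuation.map_mul, AddValuation.map_inv, addVal_series, addVal_t]
  change ((1 + -((q + 1 : ℕ) : ℤ) : ℤ) : WithTop ℤ) = _
  congr 1
  push_cast
  ring

/-- The divisor `a P_∞ + b P₀`. -/
def G (a b : ℤ) : FunField.Divisor F (FunctionField F q) :=
  Finsupp.single (Pinf F q) a + Finsupp.single (P₀ F q) b

/-- The two-point code `C(a, b)`. -/
def twoPointCode {n : ℕ} (P : Fin n → FunField.Place F (FunctionField F q)) (a b : ℤ) :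
    Set (Fin n → F) :=
  FunField.code P (G F q a b)

/-- The set `M_{P_∞}(a, b)` of pairs of rational functions. -/
def M (a b : ℤ) : Set (FunctionField F q × FunctionField F q) :=
  {p | (p.1 * p.2 ∈ FunField.riemannRoch (G F q a b) ∧
      p.1 * p.2 ∉ FunField.riemannRoch (G F q (a - 1) b)) ∧
    p.1 ∈ FunField.riemannRoch (G F q a b) ∧
    p.2 ∈ FunField.riemannRoch (G F q (a + b) 0)}

/-- The multiplicity `m_{P_∞}(a, b)`. -/
def multiplicity (a b : ℤ) : ℕ :=
  Set.ncard {i : ℤ | -b ≤ i ∧ i ≤ a + 1 ∧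
    ∃ f g, (f, g) ∈ M F q (a + 1) b ∧ (Pinf F q).ord f = ((-i : ℤ) : WithTop ℤ)}

end Places

end Hermitian

end

/-! For each `i` counted by the multiplicity pick a pair `(f i, g i)` with pole orders `i` and `a +
1 - i` at infinity. For `i < j` the product `f i * g j` has pole order at most `a` there, so it lies
in `L(aP_∞ + bP₀)` and its evaluation is orthogonal to `c`. Each `f i * g i` has pole order exactly
`a + 1`; since `L(aP_∞ + bP₀)` has codimension at most one in `L((a + 1)P_∞ + bP₀)`, orthogonality
to one such product would force orthogonality to all of `C(a + 1, b)` (`sum_mul_value_ne_zero`).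
Hence the matrix `U * diagonal c * Vᵀ`, with the values of the `f i` and `g j` as rows of `U` and
`V`, is triangular with nonzero diagonal. Its size is at most the rank of `diagonal c`, which is the
weight of `c` (`card_le_hammingNorm_of_triangular`). -/

namespace Matrix

/-- Vectors whose `c`-weighted products form a triangular array with nonzero diagonal bound the
Hamming weight of `c` from below. -/
lemma card_le_hammingNorm_of_triangular {F ι κ : Type*} [Field F] [DecidableEq F] [Fintype ι]
    [LinearOrder ι] [Fintype κ] (c : κ → F) (u v : ι → κ → F)
    (hlt : ∀ i j, i < j → ∑ k, c k * (u i k * v j k) = 0)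
    (hdiag : ∀ i, ∑ k, c k * (u i k * v i k) ≠ 0) : Fintype.card ι ≤ hammingNorm c := by
  classical
  set A : Matrix ι ι F := of u * diagonal c * (of v)ᵀ with hA
  have hentry : ∀ i j, A i j = ∑ k, c k * (u i k * v j k) := fun i j => by
    rw [hA, mul_apply]
    refine Finset.sum_congr rfl fun k _ => ?_
    rw [mul_diagonal, transpose_apply, of_apply, of_apply]
    ring
  have hdet : IsUnit A.det := by
    rw [det_of_isLowerTriangular A fun i j hij => (hentry i j).trans (hlt i j hij), isUnit_iff_ne_zero]
    exact Finset.prod_ne_zero_iff.2 fun i _ => by rw [hentry]; exact hdiag i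
  rw [← rank_of_isUnit A ((isUnit_iff_isUnit_det A).2 hdet)]
  calc A.rank ≤ (of u * diagonal c).rank := rank_mul_le_left _ _
    _ ≤ (diagonal c).rank := rank_mul_le_right _ _
    _ = hammingNorm c := by rw [rank_diagonal, hammingNorm, Fintype.card_subtype]

end Matrix

/-! ### Values of functions at rational places -/

namespace FunField

variable {F K : Type*} [Field F] [Field K] [Algebra F K]

lemma Place.ord_const_nonneg (P : Place F K) (c : F) : 0 ≤ P.ord (algebraMap F K c) := by
  by_cases hc : c = 0
  · rw [hc, map_zero, P.ord.map_zero]; exact le_top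
  · exact (P.ord_const c hc).ge

/-- Two such constants would differ by a nonzero constant of positive order, but nonzero constants
have order 0. So the choice inside `value` is harmless. -/
lemma Place.value_eq (P : Place F K) {f : K} {c : F} (h : 0 < P.ord (f - algebraMap F K c)) :
    P.value f = c := by
  have hex : ∃ c : F, 0 < P.ord (f - algebraMap F K c) := ⟨c, h⟩
  rw [Place.value, dif_pos hex]
  by_contra hne
  have h1 := P.ord.map_lt_add h ((P.ord.map_neg _).symm ▸ hex.choose_spec)
  rw [← sub_eq_add_neg, sub_sub_sub_cancel_left, ← map_sub, P.ord_const _ (sub_ne_zero.2 hne)] at h1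
  exact lt_irrefl _ h1

lemma Place.IsRational.value_spec {P : Place F K} (hP : P.IsRational) {f : K} (hf : 0 ≤ P.ord f) :
    0 < P.ord (f - algebraMap F K (P.value f)) := by
  obtain ⟨c, hc⟩ := hP f hf
  rwa [P.value_eq hc]

lemma Place.value_const (P : Place F K) (c : F) : P.value (algebraMap F K c) = c :=
  P.value_eq (by rw [sub_self, P.ord.map_zero]; exact WithTop.coe_lt_top 0)

lemma Place.IsRational.value_add {P : Place F K} (hP : P.IsRational) {f g : K}
    (hf : 0 ≤ P.ord f) (hg : 0 ≤ P.ord g) : P.value (f + g) = P.value f + P.value g := by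
  refine P.value_eq ?_
  rw [map_add, add_sub_add_comm]
  exact P.ord.map_lt_add (hP.value_spec hf) (hP.value_spec hg)

/-- Both factors must be regular: at a pole `value` is the default 0, and a pole times a zero may
have a nonzero value. -/
lemma Place.IsRational.value_mul {P : Place F K} (hP : P.IsRational) {f g : K}
    (hf : 0 ≤ P.ord f) (hg : 0 ≤ P.ord g) : P.value (f * g) = P.value f * P.value g := by
  refine P.value_eq ?_
  have h : f * g - algebraMap F K (P.value f * P.value g) =
      (f - algebraMap F K (P.value f)) * g +
        algebraMap F K (P.value f) * (g - algebraMap F K (P.value g)) := by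
    rw [map_mul]; ring
  rw [h]
  refine P.ord.map_lt_add ?_ ?_ <;> rw [P.ord.map_mul]
  · exact (hP.value_spec hf).trans_le (le_add_of_nonneg_right hg)
  · exact (hP.value_spec hg).trans_le (le_add_of_nonneg_left (P.ord_const_nonneg _))

lemma ord_nonneg_of_mem_riemannRoch {G : Divisor F K} {f : K} (hf : f ∈ riemannRoch G)
    {P : Place F K} (hP : P ∉ G.support) : 0 ≤ P.ord f := by
  have h := hf P
  rwa [Finsupp.notMem_support_iff.1 hP, neg_zero, WithTop.coe_zero] at h

end FunField

/-! ### Pole orders at infinity and the two-point divisors -/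

namespace Hermitian

open FunField

variable (F : Type*) [Field F] (q : ℕ) [Finite F] [Fact (Nat.card F = q ^ 2)]

lemma P₀_ne_Pinf : P₀ F q ≠ Pinf F q := by
  intro h
  have h1 := ord_P₀_x F q
  rw [h, ord_Pinf_x] at h1
  have h2 : (-q : ℤ) = 1 := by exact_mod_cast h1
  omega

lemma G_apply_Pinf (a b : ℤ) : G F q a b (Pinf F q) = a := by
  simp [G, Finsupp.single_eq_of_ne' (P₀_ne_Pinf F q)]

lemma G_apply_of_ne_Pinf {Q : Place F (FunctionField F q)} (hQ : Q ≠ Pinf F q) (a a' b : ℤ) :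
    G F q a b Q = G F q a' b Q := by
  simp [G, Finsupp.single_eq_of_ne hQ]

lemma G_apply_zero_of_ne_Pinf {Q : Place F (FunctionField F q)} (hQ : Q ≠ Pinf F q) (a : ℤ) :
    G F q a 0 Q = 0 := by
  simp [G, Finsupp.single_eq_of_ne hQ]

variable {F q}

/-- The two divisors differ only at infinity, so only the order there has to be checked again. -/
lemma mem_riemannRoch_G_of_ord_Pinf {a a' b : ℤ} {f : FunctionField F q}
    (hf : f ∈ riemannRoch (G F q a b)) (h : ((-a' : ℤ) : WithTop ℤ) ≤ (Pinf F q).ord f) :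
    f ∈ riemannRoch (G F q a' b) := by
  intro Q
  by_cases hQ : Q = Pinf F q
  · subst hQ; rwa [G_apply_Pinf]
  · rw [G_apply_of_ne_Pinf F q hQ a' a]; exact hf Q

lemma le_ord_Pinf_of_mem {a b : ℤ} {f : FunctionField F q}
    (hf : f ∈ riemannRoch (G F q a b)) : ((-a : ℤ) : WithTop ℤ) ≤ (Pinf F q).ord f := by
  simpa only [G_apply_Pinf] using hf (Pinf F q)

lemma ord_Pinf_of_mem_of_notMem {a b : ℤ} {f : FunctionField F q}
    (hf : f ∈ riemannRoch (G F q a b)) (hf' : f ∉ riemannRoch (G F q (a - 1) b)) :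
    (Pinf F q).ord f = ((-a : ℤ) : WithTop ℤ) := by
  have h1 := le_ord_Pinf_of_mem hf
  have h2 : (Pinf F q).ord f < ((-(a - 1) : ℤ) : WithTop ℤ) :=
    not_le.1 fun h => hf' (mem_riemannRoch_G_of_ord_Pinf hf h)
  -- The strict bound excludes order `⊤`; the only integer `m` with `-a ≤ m < -a + 1` is `-a`.
  obtain ⟨m, hm⟩ := WithTop.ne_top_iff_exists.1 (h2.trans (WithTop.coe_lt_top _)).ne
  rw [← hm] at h1 h2 ⊢
  have h1' := WithTop.coe_le_coe.1 h1
  have h2' := WithTop.coe_lt_coe.1 h2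
  exact congrArg _ (by omega)

lemma ord_right_of_ord_mul {P : Place F (FunctionField F q)} {f g : FunctionField F q} {m n : ℤ}
    (hf : P.ord f = (m : WithTop ℤ)) (hfg : P.ord (f * g) = (n : WithTop ℤ)) :
    P.ord g = ((n - m : ℤ) : WithTop ℤ) := by
  rw [P.ord.map_mul, hf] at hfg
  have hg : P.ord g ≠ ⊤ := by rintro h; rw [h, WithTop.add_top] at hfg; exact WithTop.top_ne_coe hfg
  obtain ⟨k, hk⟩ := WithTop.ne_top_iff_exists.1 hg
  rw [← hk] at hfg ⊢
  have h : m + k = n := by exact_mod_cast hfg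
  exact congrArg _ (by omega)

/-- The point at infinity is rational: leading terms can be cancelled by a constant. -/
lemma exists_ord_Pinf_sub_smul_gt {m : ℤ} {h w : FunctionField F q}
    (hh : (m : WithTop ℤ) ≤ (Pinf F q).ord h) (hw : (Pinf F q).ord w = (m : WithTop ℤ)) :
    ∃ c : F, ((m + 1 : ℤ) : WithTop ℤ) ≤ (Pinf F q).ord (h - algebraMap F _ c * w) := by
  set φ : FunctionField F q →+* LaurentSeries F := param (t F / series F q) (series F q)⁻¹
    (series_equation_inf F q) (series_inv_transcendental F q) with hφ
  have hord : ∀ f, (Pinf F q).ord f = (φ f).orderTop := fun f => HahnSeries.addVal_apply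
  rw [hord] at hh hw
  have hw0 : (φ w).coeff m ≠ 0 := HahnSeries.coeff_orderTop_ne hw
  -- Ratio of the coefficients at `t ^ m`; it is 0 when `h` already has order above `m`.
  refine ⟨(φ h).coeff m / (φ w).coeff m, ?_⟩
  rw [hord, HahnSeries.le_orderTop_iff_forall]
  intro j hj
  have hj' : j < m + 1 := by exact_mod_cast hj
  rw [map_sub, map_mul, hφ, param_const, ← hφ, HahnSeries.coeff_sub, ← HahnSeries.C_apply,
    HahnSeries.C_mul_eq_smul, HahnSeries.coeff_smul, smul_eq_mul]
  rcases (Int.lt_add_one_iff.1 hj').lt_or_eq with hlt | rfl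
  · have hlt' : (j : WithTop ℤ) < m := WithTop.coe_lt_coe.2 hlt
    rw [HahnSeries.coeff_eq_zero_of_lt_orderTop (hlt'.trans_le hh),
      HahnSeries.coeff_eq_zero_of_lt_orderTop (hlt'.trans_eq hw.symm), mul_zero, sub_zero]
  · rw [div_mul_cancel₀ _ hw0, sub_self]

/-- The coefficients `a` and `a + 1` at infinity cannot both vanish. This makes the `g j`, which may
have a pole at infinity, regular at the evaluation points. -/
lemma ne_Pinf_of_notMem_support {Q : Place F (FunctionField F q)} {a b : ℤ}
    (h : Q ∉ (G F q a b).support) (h' : Q ∉ (G F q (a + 1) b).support) : Q ≠ Pinf F q := by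
  rintro rfl
  rw [Finsupp.notMem_support_iff, G_apply_Pinf] at h h'
  omega

/-- A word orthogonal to `C(a, b)` but not to `C(a + 1, b)` detects every function of
`L(G(a + 1, b))` with pole order exactly `a + 1` at infinity. -/
lemma sum_mul_value_ne_zero {n : ℕ} {P : Fin n → Place F (FunctionField F q)}
    (hrat : ∀ k, (P k).IsRational) {a b : ℤ}
    (hsupp' : ∀ k, P k ∉ (G F q (a + 1) b).support) {c : Fin n → F}
    (horth : IsOrthogonal c (twoPointCode F q P a b))
    (hnorth : ¬ IsOrthogonal c (twoPointCode F q P (a + 1) b)) {w : FunctionField F q}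
    (hw : w ∈ riemannRoch (G F q (a + 1) b))
    (hord : (Pinf F q).ord w = ((-(a + 1) : ℤ) : WithTop ℤ)) :
    ∑ k, c k * (P k).value w ≠ 0 := by
  intro h0
  apply hnorth
  rintro _ ⟨h, hh, rfl⟩
  obtain ⟨l, hl⟩ := exists_ord_Pinf_sub_smul_gt (le_ord_Pinf_of_mem hh) hord
  -- Removing the leading term at infinity brings `h` down into `L(aP_∞ + bP₀)`, where `c` is known
  -- to vanish.
  set r := h - algebraMap F _ l * w with hr
  have hrA : r ∈ riemannRoch (G F q (a + 1) b) := by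
    rw [hr, ← Algebra.smul_def]
    exact sub_mem hh (Submodule.smul_mem _ l hw)
  have hra : r ∈ riemannRoch (G F q a b) :=
    mem_riemannRoch_G_of_ord_Pinf hrA (by convert hl using 2; ring)
  have hval : ∀ k, (P k).value h = (P k).value r + l * (P k).value w := fun k => by
    have hwk := ord_nonneg_of_mem_riemannRoch hw (hsupp' k)
    have hlk := (P k).ord_const_nonneg l
    conv_lhs => rw [show h = r + algebraMap F _ l * w by rw [hr]; ring]
    rw [(hrat k).value_add (ord_nonneg_of_mem_riemannRoch hrA (hsupp' k))
      (by rw [(P k).ord.map_mul]; exact add_nonneg hlk hwk), (hrat k).value_mul hlk hwk,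
      (P k).value_const]
  have hr0 : ∑ k, c k * (P k).value r = 0 := horth _ ⟨r, hra, rfl⟩
  calc ∑ k, c k * (P k).value h
      = ∑ k, c k * (P k).value r + l * ∑ k, c k * (P k).value w := by
        rw [Finset.mul_sum, ← Finset.sum_add_distrib]
        exact Finset.sum_congr rfl fun k _ => by rw [hval]; ring
    _ = 0 := by rw [hr0, h0, mul_zero, add_zero]

/-- The shift bound at infinity for arbitrary evaluation points, not necessarily distinct. -/
lemma multiplicity_le_hammingNorm [DecidableEq F] {n : ℕ}
    {P : Fin n → Place F (FunctionField F q)} (hrat : ∀ k, (P k).IsRational) {a b : ℤ}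
    (hsupp : ∀ k, P k ∉ (G F q a b).support) (hsupp' : ∀ k, P k ∉ (G F q (a + 1) b).support)
    {c : Fin n → F} (horth : IsOrthogonal c (twoPointCode F q P a b))
    (hnorth : ¬ IsOrthogonal c (twoPointCode F q P (a + 1) b)) :
    Hermitian.multiplicity F q a b ≤ hammingNorm c := by
  rw [Hermitian.multiplicity]
  set S : Set ℤ := {i : ℤ | -b ≤ i ∧ i ≤ a + 1 ∧
    ∃ f g, (f, g) ∈ M F q (a + 1) b ∧ (Pinf F q).ord f = ((-i : ℤ) : WithTop ℤ)}
  -- Finiteness makes `ncard` a true count rather than the default 0.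
  have hfin : S.Finite := (Set.finite_Icc (-b) (a + 1)).subset fun i hi => ⟨hi.1, hi.2.1⟩
  have : Fintype S := hfin.fintype
  rw [← Nat.card_coe_set_eq, Nat.card_eq_fintype_card]
  choose f g hM hf using fun i : S => i.2.2.2
  have hfgA : ∀ i, f i * g i ∈ riemannRoch (G F q (a + 1) b) := fun i => (hM i).1.1
  have hfA : ∀ i, f i ∈ riemannRoch (G F q (a + 1) b) := fun i => (hM i).2.1
  have hfg : ∀ i, (Pinf F q).ord (f i * g i) = ((-(a + 1) : ℤ) : WithTop ℤ) := fun i =>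
    ord_Pinf_of_mem_of_notMem (hM i).1.1 (hM i).1.2
  have hg0 : ∀ i Q, Q ≠ Pinf F q → 0 ≤ Q.ord (g i) := fun i Q hQ => by
    refine ord_nonneg_of_mem_riemannRoch (hM i).2.2 ?_
    rw [Finsupp.notMem_support_iff, G_apply_zero_of_ne_Pinf F q hQ]
  have hmul : ∀ i j k, (P k).value (f i * g j) = (P k).value (f i) * (P k).value (g j) :=
    fun i j k => (hrat k).value_mul (ord_nonneg_of_mem_riemannRoch (hfA i) (hsupp' k))
      (hg0 j _ (ne_Pinf_of_notMem_support (hsupp k) (hsupp' k)))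
  refine Matrix.card_le_hammingNorm_of_triangular c (fun i k => (P k).value (f i))
    (fun i k => (P k).value (g i)) (fun i j hij => ?_) (fun i => ?_) <;> simp only [← hmul]
  · refine horth _ ⟨f i * g j, fun Q => ?_, rfl⟩
    rw [Q.ord.map_mul]
    by_cases hQ : Q = Pinf F q
    · subst hQ
      -- The order of `f i * g j` is `-i + (j - (a + 1))`, which is at least `-a` precisely because
      -- `i < j` are integers.
      rw [G_apply_Pinf, hf, ord_right_of_ord_mul (hf j) (hfg j), ← WithTop.coe_add,
        WithTop.coe_le_coe]
      have : (i : ℤ) < j := hij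
      omega
    -- Away from infinity `g j` has no poles, so `f i` alone accounts for the bound at `P₀`.
    · rw [G_apply_of_ne_Pinf F q hQ a (a + 1)]
      exact le_add_of_le_of_nonneg (hfA i Q) (hg0 j Q hQ)
  · exact sum_mul_value_ne_zero hrat hsupp' horth hnorth (hfgA i) (hfg i)

end Hermitian

theorem theorem2p1 (F : Type*) [Field F] [Finite F] [DecidableEq F] (q : ℕ) [Fact (Nat.card F = q ^ 2)]
    (n : ℕ) (P : Fin n → FunField.Place F (Hermitian.FunctionField F q))
    (hrat : ∀ k, (P k).IsRational) (hdistinct : Function.Injective P) (a b : ℤ)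
    (hsupp : ∀ k, P k ∉ (Hermitian.G F q a b).support)
    (hsupp' : ∀ k, P k ∉ (Hermitian.G F q (a + 1) b).support)
    (c : Fin n → F)
    (horth : FunField.IsOrthogonal c (Hermitian.twoPointCode F q P a b))
    (hnorth : ¬ FunField.IsOrthogonal c (Hermitian.twoPointCode F q P (a + 1) b)) :
    Hermitian.multiplicity F q a b ≤ hammingNorm c :=
  Hermitian.multiplicity_le_hammingNorm hrat hsupp hsupp' horth hnorth
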